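/- Let $\mathbb N=\{1,2,3,\dots\}$ with multiplication, identified with $\mathbb G=\bigoplus_{p\text{ prime}}\mathbb N_p$, where each $\mathbb N_p$ is $(\mathbb N\cup\{0\},+)$, through $(k_p)_p\mapsto\prod_p p^{k_p}$. An anchored rectangular box is a set $F=\prod_p\{0,1,\dots,k_p\}\subset\mathbb G$ with $k_p=0$ for all but finitely many $p$ (equivalently, the set of all divisors of $L=\prod_p p^{k_p}$). The family $\mathcal F$ of all anchored rectangular boxes is directed by inclusion. A sequence $(F_n)$ of finite subsets of $(\mathbb N,\times)$ is a Følner sequence if $|\{h\in F_n: gh\in F_n\}|/|F_n|\to1$ for every $g\in\mathbb N$; it is nice if, in addition, each $F_n$ is an anchored rectangular box and $F_n\subsetneq F_{n+1}$ for all $n$. For a set $A\subset\mathbb N$, a nonempty finite set $K\subset\mathbb N$, a block $B\in\{0,1\}^K$ and a finite set $F\subset\mathbb N$ let $$\mathsf N(B,A,F)=\bigl|\{g\in\mathbb N:\ hg\in F\text{ and }\mathbf 1_A(hg)=B(h)\text{ for all }h\in K\}\bigr|.$$ The set $A$ is $(F_n)$-normal if $\frac1{|F_n|}\mathsf N(B,A,F_n)\to2^{-|K|}$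 for every nonempty finite $K\subset\mathbb N$ and every $B\in\{0,1\}^K$. It is net-normal if, for all such $K$ and $B$, the net $\bigl(\frac1{|F|}\mathsf N(B,A,F)\bigr)_{F\in\mathcal F}$ converges to $2^{-|K|}$. **Theorem.** There exists an effectively defined (that is, computable: some algorithm decides, for every $n\in\mathbb N$, whether $n\in A$) net-normal set $A\subset\mathbb N$; this set is $(F_n)$-normal for every nice Følner sequence $(F_n)$ in $(\mathbb N,\times)$. Moreover, an arbitrary set $A\subset\mathbb N$ is net-normal if and only if it is $(F_n)$-normal for every nice Følner sequence $(F_n)$ in $(\mathbb N,\times)$. -/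

import Mathlib

open Filter Topology

noncomputable section

/-- `N(B, x, F)`: the set of positions `g` at which a shift of the block `B ∈ {0,1}^K` occurs
in the restriction of `x ∈ {0,1}^G` to the finite set `F`. -/
def blockOccurrences {G : Type*} [Monoid G] {K : Finset G} (B : K → Fin 2) (x : G → Fin 2)
    (F : Finset G) : Set G :=
  {g : G | ∀ h : K, (h : G) * g ∈ F ∧ x ((h : G) * g) = B h}

/-- The frequency `|N(B, x, F)| / |F|`. -/
def blockFrequency {G : Type*} [Monoid G] {K : Finset G} (B : K → Fin 2) (x : G → Fin 2)
    (F : Finset G) : ℝ :=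
  ((blockOccurrences B x F).ncard : ℝ) / (F.card : ℝ)

/-- Følner sequences in a monoid: `|F_n ∩ g⁻¹ F_n| / |F_n| → 1` for every `g`, where
`g⁻¹ F = {h | g h ∈ F}`. -/
def IsFolnerSequence {G : Type*} [Monoid G] (F : ℕ → Finset G) : Prop :=
  ∀ g : G, Tendsto
    (fun n => (((F n : Set G) ∩ {h : G | g * h ∈ F n}).ncard : ℝ) / ((F n).card : ℝ))
    atTop (𝓝 1)

/-- The set `A` (that is, its indicator function) is `(F_n)`-normal. -/
def IsNormalAlong {G : Type*} [Monoid G] (F : ℕ → Finset G) (A : Set G) : Prop :=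
  ∀ K : Finset G, K.Nonempty → ∀ B : K → Fin 2,
    Tendsto (fun n => blockFrequency B (A.indicator 1) (F n)) atTop
      (𝓝 (((2 : ℝ) ^ K.card)⁻¹))

/-- The isomorphism `⊕_p ℕ_p ≅ (ℕ, ×)`, `(k_p) ↦ ∏ p ^ k_p`. -/
def ofExponents (k : Nat.Primes →₀ ℕ) : ℕ+ :=
  k.prod fun p e => (p : ℕ+) ^ e

/-- The anchored rectangular box `∏_p {0, 1, …, k_p}` of `⊕_p ℕ_p`, seen in `(ℕ, ×)`. -/
def anchoredBox (k : Nat.Primes →₀ ℕ) : Finset ℕ+ :=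
  (Finset.Icc 0 k).image ofExponents

/-- The family of all anchored rectangular boxes, ordered by inclusion (the Følner net). -/
abbrev AnchoredBoxes : Type :=
  {F : Finset ℕ+ // ∃ k : Nat.Primes →₀ ℕ, F = anchoredBox k}

/-- Nice Følner sequences in `(ℕ, ×)`: Følner sequences of anchored rectangular boxes that
strictly increase with respect to inclusion. -/
def IsNiceFolnerSequence (F : ℕ → Finset ℕ+) : Prop :=
  IsFolnerSequence F ∧ (∀ n, ∃ k : Nat.Primes →₀ ℕ, F n = anchoredBox k) ∧ StrictMono F

/-- Net-normality: the frequency of every block converges along the Følner net. -/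
def IsNetNormal (A : Set ℕ+) : Prop :=
  ∀ K : Finset ℕ+, K.Nonempty → ∀ B : K → Fin 2,
    Tendsto (fun F : AnchoredBoxes => blockFrequency B (A.indicator 1) (F : Finset ℕ+)) atTop
      (𝓝 (((2 : ℝ) ^ K.card)⁻¹))

/-- `A` is effectively defined: an algorithm decides, for every positive integer, after finitely
many steps whether it belongs to `A`. The positive integer `n + 1` is coded by `n`. -/
def IsEffectivelyDefined (A : Set ℕ+) : Prop :=
  ComputablePred fun n : ℕ => n.succPNat ∈ A

end

/-! A box is the set of divisors of its top corner `L`, so convergence along the net means control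
for all multiples `L` of a suitable `L₀`. A Følner sequence of boxes eventually has every given
number among the divisors of its corners, hence is cofinal in the net. Conversely, if net-normality
fails, bad boxes exist above every box and can be chained into a nice Følner sequence
(`isNetNormal_iff`).

For the example, write `n = 2 ^ a * m` with `m` odd and split the divisors of `L` into lines on
which `m` is fixed. Stage `s` cuts a line into windows of length `2 ^ s`; the window with number `v`
carries the binary digits of `v`, the digit at offset `t` being bit `t * 2 ^ s + m % 2 ^ s`. A block
with cells `2 ^ b * o` tests offsets `t + b` and residues `o * m`. As `m` is odd, distinct cells
test distinct bits once `2 ^ s` exceeds every `o`, unless the block leaves the window. While `v`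
runs through all values of its lowest `2 ^ s * 2 ^ s` bits, each block therefore has exactly the
right frequency (`sum_patternDeviation_window_eq_zero`). The exceptional offsets have density `O(2 ^
(-s))`, and stages are long compared with periods, so averages over initial segments of lines
converge uniformly in `m` (`exists_abs_sum_patternDeviation_le`).

Summing over `m` counts the occurrences at divisors of `L`; almost invariance of the divisor set
(`exists_card_filter_not_mul_dvd_le`) shows that few of them leave the box. -/

/-! ### Divisor sets: lines in a prime direction and almost invariance -/

/-- Splits the divisors into lines in the direction of `p`: needed for every `p` to prove almost
invariance, and for `p = 2` to prove normality. -/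
theorem sum_divisors_prime_pow_mul {R : Type*} [AddCommMonoid R] {p : ℕ} (hp : p.Prime) (k : ℕ)
    {M : ℕ} (hM : ¬ p ∣ M) (f : ℕ → R) :
    ∑ d ∈ (p ^ k * M).divisors, f d =
      ∑ m ∈ M.divisors, ∑ i ∈ Finset.range (k + 1), f (p ^ i * m) := by
  open scoped Pointwise in
  rw [Nat.divisors_mul, Finset.mul_def, Finset.sum_image
    (Nat.Coprime.mul_injOn_divisors
      (Nat.Coprime.pow_left k ((Nat.Prime.coprime_iff_not_dvd hp).2 hM))),
    Finset.sum_product_right, Nat.divisors_prime_pow hp]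
  simp

theorem exists_eq_prime_pow_mul {p : ℕ} (hp : p.Prime) {n : ℕ} (hn : n ≠ 0) :
    ∃ k m, ¬ p ∣ m ∧ n = p ^ k * m :=
  Nat.exists_eq_pow_mul_and_not_dvd hn p hp.ne_one

/-- The proportion of the divisors `d` of `L` with `p * d ∤ L` is `1 / (k + 1)`, where `p ^ k` is
the exact power of the prime `p` in `L`. -/
theorem card_filter_not_prime_mul_dvd {p : ℕ} (hp : p.Prime) (k : ℕ) {M : ℕ} (hM : ¬ p ∣ M) :
    ((p ^ k * M).divisors.filter fun d => ¬ p * d ∣ p ^ k * M).card * (k + 1) =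
      (p ^ k * M).divisors.card := by
  rw [Finset.card_filter, sum_divisors_prime_pow_mul hp k hM, Finset.card_eq_sum_ones,
    sum_divisors_prime_pow_mul hp k hM, Finset.sum_mul]
  refine Finset.sum_congr rfl fun m hm => ?_
  have hm' := Nat.dvd_of_mem_divisors hm
  -- On each line only the endpoint `i = k` leaves the divisor set.
  rw [Finset.sum_range_succ, Finset.sum_eq_zero]
  · have : ¬ p * (p ^ k * m) ∣ p ^ k * M := by
      intro h
      rw [mul_left_comm, Nat.mul_dvd_mul_iff_left (pow_pos hp.pos k)] at h
      exact hM (dvd_of_mul_right_dvd h)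
    simp [this]
  · intro i hi
    have : p * (p ^ i * m) ∣ p ^ k * M := by
      rw [← mul_assoc, ← pow_succ']
      exact mul_dvd_mul (pow_dvd_pow p (Finset.mem_range.1 hi)) hm'
    simp [this]

/-- The set of divisors of `L` is almost invariant under multiplication by `h` if `L` is a
multiple of a suitable number. -/
theorem exists_card_filter_not_mul_dvd_le {h : ℕ} (hh : h ≠ 0) {ε : ℝ} (hε : 0 < ε) :
    ∃ L₀ ≠ 0, ∀ L ≠ 0, L₀ ∣ L →
      ((L.divisors.filter fun d => ¬ h * d ∣ L).card : ℝ) ≤ ε * L.divisors.card := by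
  induction h using induction_on_primes generalizing ε with
  | zero => simp at hh
  | one =>
    refine ⟨1, one_ne_zero, fun L hL _ => ?_⟩
    rw [Finset.filter_false_of_mem]
    · simp; positivity
    · intro d hd
      simpa using Nat.dvd_of_mem_divisors hd
  | prime_mul p a hp ih =>
    have ha : a ≠ 0 := by rintro rfl; simp at hh
    obtain ⟨L₁, hL₁, H⟩ := ih ha (half_pos hε)
    -- Once `p ^ N` divides `L`, the proportion `1 / (k + 1)` lost to the factor `p` is below `ε /
    -- 2`.
    obtain ⟨N, hN⟩ := exists_nat_gt (2 / ε)
    refine ⟨L₁ * p ^ N, mul_ne_zero hL₁ (pow_ne_zero _ hp.ne_zero), fun L hL hdvd => ?_⟩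
    have h1 := H L hL (dvd_of_mul_right_dvd hdvd)
    have h2 : (L.divisors.filter fun d => ¬ p * a * d ∣ L).card ≤
        (L.divisors.filter fun d => ¬ a * d ∣ L).card +
          (L.divisors.filter fun d => ¬ p * d ∣ L).card := by
      have : (L.divisors.filter fun d => ¬ p * a * d ∣ L) ⊆
          (L.divisors.filter fun d => ¬ a * d ∣ L) ∪
            (L.divisors.filter fun d => a * d ∣ L ∧ ¬ p * (a * d) ∣ L) := by
        intro d
        simp only [Finset.mem_filter, Finset.mem_union, mul_assoc]
        tauto
      refine (Finset.card_le_card this).trans ((Finset.card_union_le _ _).trans ?_)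
      -- Multiplication by `a` injects the second set into the divisors that `p` moves out.
      refine Nat.add_le_add_left (Finset.card_le_card_of_injOn (fun d => a * d) ?_ ?_) _
      · intro d hd
        simp only [Finset.coe_filter, Set.mem_ofPred_eq, Nat.mem_divisors] at hd ⊢
        tauto
      · intro x _ y _ hxy
        exact Nat.eq_of_mul_eq_mul_left (Nat.pos_of_ne_zero ha) hxy
    obtain ⟨k, M, hM, rfl⟩ := exists_eq_prime_pow_mul hp hL
    have h3 := card_filter_not_prime_mul_dvd hp k hM
    have hk : N ≤ k := by
      have h4 : p ^ N ∣ p ^ k * M := dvd_of_mul_left_dvd hdvd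
      have h5 := Nat.Coprime.dvd_of_dvd_mul_right
        (Nat.Coprime.pow_left N ((Nat.Prime.coprime_iff_not_dvd hp).2 hM)) h4
      exact (Nat.pow_dvd_pow_iff_le_right hp.one_lt).1 h5
    have h6 : 2 / ε < k + 1 := hN.trans_le (by exact_mod_cast hk.trans (Nat.le_succ k))
    rw [div_lt_iff₀ hε] at h6
    set D := (p ^ k * M).divisors.filter fun d => ¬ p * d ∣ p ^ k * M
    have h7 : (D.card : ℝ) * (k + 1) = ((p ^ k * M).divisors.card : ℝ) := by exact_mod_cast h3
    have h8 : (D.card : ℝ) ≤ ε / 2 * ((p ^ k * M).divisors.card : ℝ) := by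
      rw [← h7]
      nlinarith [Nat.cast_nonneg (α := ℝ) D.card]
    have h9 : ((((p ^ k * M).divisors.filter fun d => ¬ p * a * d ∣ p ^ k * M).card : ℕ) : ℝ) ≤
        ((((p ^ k * M).divisors.filter fun d => ¬ a * d ∣ p ^ k * M).card : ℕ) : ℝ) +
          (D.card : ℝ) := by exact_mod_cast h2
    linarith

/-! ### Anchored boxes as divisor sets -/

/-- The inclusion of the primes into the natural numbers. -/
def primesEmbedding : Nat.Primes ↪ ℕ :=
  ⟨fun p => p, Nat.Primes.coe_nat_injective⟩

theorem coe_ofExponents (k : Nat.Primes →₀ ℕ) :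
    (ofExponents k : ℕ) = (k.embDomain primesEmbedding).prod (· ^ ·) := by
  rw [Finsupp.prod_embDomain, ofExponents, Finsupp.prod, Finsupp.prod, ← PNat.coe_coeMonoidHom,
    map_prod]
  simp
  rfl

theorem factorization_ofExponents (k : Nat.Primes →₀ ℕ) :
    (ofExponents k : ℕ).factorization = k.embDomain primesEmbedding := by
  classical
  rw [coe_ofExponents]
  refine Nat.prod_pow_factorization_eq_self fun p hp => ?_
  rw [Finsupp.support_embDomain] at hp
  obtain ⟨q, -, rfl⟩ := Finset.mem_map.1 hp
  exact q.2

theorem factorization_ofExponents_apply (k : Nat.Primes →₀ ℕ) (p : Nat.Primes) :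
    (ofExponents k : ℕ).factorization p = k p := by
  rw [factorization_ofExponents]
  exact Finsupp.embDomain_apply_self primesEmbedding k p

theorem ofExponents_surjective (n : ℕ+) : ∃ k, ofExponents k = n := by
  refine ⟨(n : ℕ).factorization.comapDomain ((↑) : Nat.Primes → ℕ)
    Nat.Primes.coe_nat_injective.injOn, ?_⟩
  refine PNat.eq (Nat.eq_of_factorization_eq (PNat.ne_zero _) (PNat.ne_zero _) fun p => ?_)
  by_cases hp : p.Prime
  · exact factorization_ofExponents_apply _ ⟨p, hp⟩
  · rw [Nat.factorization_eq_zero_of_not_prime _ hp, Nat.factorization_eq_zero_of_not_prime _ hp]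

theorem ofExponents_dvd_iff {j k : Nat.Primes →₀ ℕ} :
    (ofExponents j : ℕ) ∣ ofExponents k ↔ j ≤ k := by
  rw [← Nat.factorization_le_iff_dvd (PNat.ne_zero _) (PNat.ne_zero _)]
  constructor
  · intro h p
    simpa only [factorization_ofExponents_apply] using h p
  · intro h p
    by_cases hp : p.Prime
    · exact (factorization_ofExponents_apply j ⟨p, hp⟩).trans_le
        ((h ⟨p, hp⟩).trans_eq (factorization_ofExponents_apply k ⟨p, hp⟩).symm)
    · rw [Nat.factorization_eq_zero_of_not_prime _ hp]
      exact Nat.zero_le _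

/-- The anchored box with top corner `L` is the set of divisors of `L`. -/
theorem mem_anchoredBox {k : Nat.Primes →₀ ℕ} {d : ℕ+} :
    d ∈ anchoredBox k ↔ (d : ℕ) ∣ ofExponents k := by
  rw [anchoredBox, Finset.mem_image]
  constructor
  · rintro ⟨j, hj, rfl⟩
    exact ofExponents_dvd_iff.2 (Finset.mem_Icc.1 hj).2
  · intro h
    obtain ⟨j, rfl⟩ := ofExponents_surjective d
    exact ⟨j, Finset.mem_Icc.2 ⟨zero_le, ofExponents_dvd_iff.1 h⟩, rfl⟩

/-- Counting in a box amounts to counting divisors. -/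
theorem ncard_setOf_eq_card_filter_divisors {L : ℕ} (hL : L ≠ 0) (S : Set ℕ+) (p : ℕ → Prop)
    [DecidablePred p] (hS : ∀ d : ℕ+, d ∈ S ↔ (d : ℕ) ∣ L ∧ p d) :
    S.ncard = (L.divisors.filter p).card := by
  rw [← Set.ncard_coe_finset, ← Set.ncard_image_of_injective S PNat.coe_injective]
  congr 1
  ext d
  simp only [Set.mem_image, Finset.coe_filter, Nat.mem_divisors, Set.mem_ofPred_eq, hS]
  constructor
  · rintro ⟨d, h, rfl⟩
    exact ⟨⟨h.1, hL⟩, h.2⟩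
  · rintro ⟨⟨h, -⟩, h'⟩
    exact ⟨⟨d, Nat.pos_of_dvd_of_pos h (Nat.pos_of_ne_zero hL)⟩, ⟨h, h'⟩, rfl⟩

theorem card_anchoredBox (k : Nat.Primes →₀ ℕ) :
    (anchoredBox k).card = (ofExponents k : ℕ).divisors.card := by
  rw [← Set.ncard_coe_finset, ncard_setOf_eq_card_filter_divisors
    (PNat.ne_zero (ofExponents k)) _ (fun _ => True)]
  · simp
  · intro d
    simp [mem_anchoredBox]

theorem anchoredBox_subset_iff {j k : Nat.Primes →₀ ℕ} :
    anchoredBox j ⊆ anchoredBox k ↔ (ofExponents j : ℕ) ∣ ofExponents k := by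
  constructor
  · intro h
    exact mem_anchoredBox.1 (h (mem_anchoredBox.2 dvd_rfl))
  · intro h d hd
    exact mem_anchoredBox.2 ((mem_anchoredBox.1 hd).trans h)

theorem card_divisors_pos {L : ℕ} (hL : L ≠ 0) : (0 : ℝ) < L.divisors.card := by
  exact_mod_cast Finset.card_pos.2 (Nat.nonempty_divisors.2 hL)

/-! ### Følner sequences of boxes and the Følner net -/

/-- Along any Følner sequence of anchored boxes every given number divides the top corner
eventually. -/
theorem IsFolnerSequence.eventually_dvd {k : ℕ → Nat.Primes →₀ ℕ}
    (hF : IsFolnerSequence fun n => anchoredBox (k n)) (g : ℕ+) :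
    ∀ᶠ n in atTop, (g : ℕ) ∣ ofExponents (k n) := by
  filter_upwards [(hF g).eventually (lt_mem_nhds zero_lt_one)] with n hn
  by_contra hg
  -- If `g` does not divide the corner, no multiple of `g` lies in the box and the ratio is `0`.
  rw [show ((anchoredBox (k n) : Set ℕ+) ∩ {h : ℕ+ | g * h ∈ anchoredBox (k n)}) = ∅ from ?_] at hn
  · simp at hn
  · ext h
    simp only [Set.mem_inter_iff, Set.mem_ofPred_eq, mem_anchoredBox, PNat.mul_coe,
      Set.mem_empty_iff_false, iff_false, not_and]
    exact fun _ h' => hg (dvd_of_mul_right_dvd h')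

theorem isFolnerSequence_of_eventually_dvd {k : ℕ → Nat.Primes →₀ ℕ}
    (hk : ∀ g : ℕ+, ∀ᶠ n in atTop, (g : ℕ) ∣ ofExponents (k n)) :
    IsFolnerSequence fun n => anchoredBox (k n) := by
  intro g
  rw [Metric.tendsto_nhds]
  intro ε hε
  obtain ⟨L₀, hL₀, H⟩ := exists_card_filter_not_mul_dvd_le g.ne_zero (half_pos hε)
  filter_upwards [hk ⟨L₀, Nat.pos_of_ne_zero hL₀⟩] with n hn
  have h1 := H _ (PNat.ne_zero _) hn
  have h0 := card_divisors_pos (PNat.ne_zero (ofExponents (k n)))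
  rw [card_anchoredBox, ncard_setOf_eq_card_filter_divisors (PNat.ne_zero (ofExponents (k n))) _
    (fun d => (g : ℕ) * d ∣ ofExponents (k n))]
  · have h2 := Finset.card_filter_add_card_filter_not (s := (ofExponents (k n) : ℕ).divisors)
      (fun d => (g : ℕ) * d ∣ ofExponents (k n))
    have h3 : (((ofExponents (k n) : ℕ).divisors.filter
        fun d => (g : ℕ) * d ∣ ofExponents (k n)).card : ℝ) +
        (((ofExponents (k n) : ℕ).divisors.filter
        fun d => ¬ (g : ℕ) * d ∣ ofExponents (k n)).card : ℝ) =
        ((ofExponents (k n) : ℕ).divisors.card : ℝ) := by exact_mod_cast h2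
    rw [Real.dist_eq, div_sub_one h0.ne', abs_div, abs_of_pos h0, div_lt_iff₀ h0, ← h3,
      sub_add_cancel_left, abs_neg, abs_of_nonneg (Nat.cast_nonneg _), h3]
    nlinarith
  · intro d
    simp [mem_anchoredBox]

/-- Net-normality is normality along all nice Følner sequences. -/
theorem isNetNormal_iff (A : Set ℕ+) :
    IsNetNormal A ↔ ∀ F : ℕ → Finset ℕ+, IsNiceFolnerSequence F → IsNormalAlong F A := by
  constructor
  · intro hA F hF K hK B
    obtain ⟨hF1, hF2, -⟩ := hF
    have : Tendsto (fun n => (⟨F n, hF2 n⟩ : AnchoredBoxes)) atTop atTop := by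
      choose k hk using id hF2
      have hF : IsFolnerSequence fun n => anchoredBox (k n) := by rwa [← funext hk]
      rw [tendsto_atTop]
      rintro ⟨_, j, rfl⟩
      filter_upwards [hF.eventually_dvd (ofExponents j)] with n hn
      have h := anchoredBox_subset_iff.2 hn
      rw [← hk n] at h
      exact h
    have h := (hA K hK B).comp this
    rw [Function.comp_def] at h
    exact h
  · intro H K hK B
    by_contra hcon
    rw [Metric.tendsto_nhds] at hcon
    push Not at hcon
    obtain ⟨ε, hε, hbad⟩ := hcon
    have hbad' : ∀ L : ℕ+, ∃ k : Nat.Primes →₀ ℕ, (L : ℕ) ∣ ofExponents k ∧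
        ε ≤ dist (blockFrequency B (A.indicator 1) (anchoredBox k)) (((2 : ℝ) ^ K.card)⁻¹) := by
      intro L
      obtain ⟨j, rfl⟩ := ofExponents_surjective L
      by_contra hno
      push Not at hno
      refine hbad ?_
      filter_upwards [eventually_ge_atTop (⟨anchoredBox j, j, rfl⟩ : AnchoredBoxes)]
      rintro ⟨_, k, rfl⟩ hk
      exact not_le.2 (hno k (anchoredBox_subset_iff.1 hk))
    choose next hdvd hdist using hbad'
    -- The factorials force every number to divide the corners eventually. Starting them at `2!`
    -- multiplies each corner by at least `2`, so the inclusions are strict.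
    let k : ℕ → Nat.Primes →₀ ℕ :=
      fun n => Nat.rec (next 1) (fun n j => next (ofExponents j * (n + 2).factorial.toPNat')) n
    have hsucc (n : ℕ) : k (n + 1) = next (ofExponents (k n) * (n + 2).factorial.toPNat') := rfl
    have hd (n : ℕ) : (ofExponents (k n) : ℕ) * (n + 2).factorial ∣ ofExponents (k (n + 1)) := by
      rw [hsucc]
      simpa [Nat.toPNat'_coe, Nat.factorial_pos] using
        hdvd (ofExponents (k n) * (n + 2).factorial.toPNat')
    have hfol : IsFolnerSequence fun n => anchoredBox (k n) := by
      refine isFolnerSequence_of_eventually_dvd fun g => ?_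
      filter_upwards [eventually_ge_atTop (g : ℕ)] with n hn
      obtain ⟨m, rfl⟩ : ∃ m, n = m + 1 := ⟨n - 1, by have := g.pos; omega⟩
      exact ((Nat.dvd_factorial g.pos (hn.trans (by omega))).trans
        (Nat.dvd_mul_left _ _)).trans (hd m)
    have hmono : StrictMono fun n => anchoredBox (k n) := by
      refine strictMono_nat_of_lt_succ fun n => ?_
      refine Finset.ssubset_iff_subset_ne.2
        ⟨anchoredBox_subset_iff.2 (dvd_of_mul_right_dvd (hd n)), fun heq => ?_⟩
      have h1 : (ofExponents (k (n + 1)) : ℕ) ∣ ofExponents (k n) :=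
        anchoredBox_subset_iff.1 heq.symm.subset
      have h2 := Nat.le_of_dvd (PNat.pos _) ((hd n).trans h1)
      have h3 := (ofExponents (k n)).pos
      have h4 := Nat.self_le_factorial (n + 2)
      nlinarith
    have hgood := H _ ⟨hfol, fun n => ⟨k n, rfl⟩, hmono⟩ K hK B
    rw [Metric.tendsto_nhds] at hgood
    obtain ⟨n, hn⟩ := (hgood ε hε).exists
    refine absurd hn (not_lt.2 ?_)
    cases n with
    | zero => exact hdist 1
    | succ n => exact hdist _

/-! ### The construction and its computability -/

/-- The exponent of `2` in `n`. -/
def twoExponent (n : ℕ) : ℕ :=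
  Nat.findGreatest (fun i => 2 ^ i ∣ n) n

/-- The stage of the position `a`: the greatest `s ≤ a` with `2 ^ 16 ^ s ≤ a`. -/
def stage (a : ℕ) : ℕ :=
  Nat.findGreatest (fun s => 2 ^ 16 ^ s ≤ a) a

/-- The binary digit attached to `2 ^ a * m`, `m` odd. In stage `s`, windows of length `2 ^ s` in
the direction of `2` are numbered consecutively, and the binary digits of the number of the window
are distributed over the positions in the window and the residues of `m` modulo `2 ^ s`. -/
def windowDigit (a m : ℕ) : Bool :=
  (a / 2 ^ stage a).testBit (a % 2 ^ stage a * 2 ^ stage a + m % 2 ^ stage a)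

def normalDigit (n : ℕ) : Bool :=
  windowDigit (twoExponent n) (n / 2 ^ twoExponent n)

/-- An effectively defined net-normal set. -/
def normalSet : Set ℕ+ :=
  {n | normalDigit n = true}

theorem primrec_pow : Primrec₂ ((· ^ ·) : ℕ → ℕ → ℕ) :=
  Primrec₂.unpaired'.1 Nat.Primrec.pow

theorem primrec_two_pow {α : Type*} [Primcodable α] {f : α → ℕ} (hf : Primrec f) :
    Primrec fun a => 2 ^ f a :=
  primrec_pow.comp (Primrec.const 2) hf

theorem primrec_twoExponent : Primrec twoExponent := by
  refine Primrec.nat_findGreatest Primrec.id ?_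
  refine PrimrecPred.of_eq (Primrec.eq.comp (Primrec.nat_mod.comp Primrec.fst
    (primrec_two_pow Primrec.snd)) (Primrec.const 0)) fun x => ?_
  exact (Nat.dvd_iff_mod_eq_zero ..).symm

theorem primrec_stage : Primrec stage := by
  refine Primrec.nat_findGreatest Primrec.id ?_
  exact Primrec.nat_le.comp (primrec_two_pow (primrec_pow.comp (Primrec.const 16) Primrec.snd))
    Primrec.fst

theorem primrec_testBit : Primrec₂ Nat.testBit := by
  refine (PrimrecPred.decide (Primrec.eq.comp (Primrec.nat_mod.comp (Primrec.nat_div.comp Primrec.fst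
    (primrec_two_pow Primrec.snd)) (Primrec.const 2)) (Primrec.const 1))).of_eq fun x => ?_
  exact (Nat.testBit_eq_decide_div_mod_eq ..).symm

theorem primrec_windowDigit : Primrec₂ windowDigit := by
  have hs : Primrec fun x : ℕ × ℕ => 2 ^ stage x.1 :=
    primrec_two_pow (primrec_stage.comp Primrec.fst)
  exact primrec_testBit.comp (Primrec.nat_div.comp Primrec.fst hs)
    (Primrec.nat_add.comp (Primrec.nat_mul.comp (Primrec.nat_mod.comp Primrec.fst hs) hs)
      (Primrec.nat_mod.comp Primrec.snd hs))

theorem isEffectivelyDefined_normalSet : IsEffectivelyDefined normalSet := by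
  have h : Primrec normalDigit := primrec_windowDigit.comp primrec_twoExponent
    (Primrec.nat_div.comp Primrec.id (primrec_two_pow primrec_twoExponent))
  refine PrimrecPred.computablePred (PrimrecPred.of_eq
    (Primrec.eq.comp (h.comp Primrec.succ) (Primrec.const true)) fun n => Iff.rfl)

/-! ### Digits, stages and counting binary patterns -/

theorem twoExponent_two_pow_mul (a : ℕ) {m : ℕ} (hm : ¬ 2 ∣ m) : twoExponent (2 ^ a * m) = a := by
  have hm0 : 0 < m := Nat.pos_of_ne_zero (by rintro rfl; simp at hm)
  rw [twoExponent, Nat.findGreatest_eq_iff]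
  refine ⟨Nat.lt_two_pow_self.le.trans (Nat.le_mul_of_pos_right _ hm0),
    fun _ => dvd_mul_right _ _, fun i hi _ h => ?_⟩
  have h1 : 2 ^ (a + 1) ∣ 2 ^ a * m := (pow_dvd_pow 2 hi).trans h
  rw [pow_succ, Nat.mul_dvd_mul_iff_left (by positivity)] at h1
  exact hm h1

theorem normalDigit_two_pow_mul (a : ℕ) {m : ℕ} (hm : ¬ 2 ∣ m) :
    normalDigit (2 ^ a * m) = windowDigit a m := by
  rw [normalDigit, twoExponent_two_pow_mul a hm, Nat.mul_div_cancel_left _ (by positivity)]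

/-- The value `0` of `stage` is also the default of `Nat.findGreatest` when no `s` qualifies (`a <
2`), hence the restriction to `1 ≤ s`. -/
theorem le_stage_iff {s a : ℕ} (hs : 1 ≤ s) : s ≤ stage a ↔ 2 ^ 16 ^ s ≤ a := by
  constructor
  · intro h
    have h1 : 2 ^ 16 ^ stage a ≤ a :=
      Nat.findGreatest_of_ne_zero (P := fun s => 2 ^ 16 ^ s ≤ a) (n := a) rfl (by omega)
    exact (Nat.pow_le_pow_right two_pos (Nat.pow_le_pow_right (by norm_num) h)).trans h1
  · intro h
    refine Nat.le_findGreatest ?_ h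
    exact ((Nat.lt_pow_self (by norm_num : 1 < 16)).le.trans Nat.lt_two_pow_self.le).trans h

/-- Prescribing `r` of the first `N` binary digits leaves `2 ^ (N - r)` possibilities. -/
theorem card_filter_testBit {ι : Type*} (pos : ι → ℕ) (β : ι → Bool) (N : ℕ) (s : Finset ι)
    (hpos : ∀ i ∈ s, pos i < N) (hinj : Set.InjOn pos s) :
    ((Finset.range (2 ^ N)).filter fun v => ∀ i ∈ s, v.testBit (pos i) = β i).card * 2 ^ s.card =
      2 ^ N := by
  classical
  induction s using Finset.induction_on with
  | empty => simp
  | insert j s hj ih =>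
    have ih' := ih (fun i hi => hpos i (Finset.mem_insert_of_mem hi))
      (hinj.mono (by simp))
    set S := (Finset.range (2 ^ N)).filter fun v => ∀ i ∈ s, v.testBit (pos i) = β i with hS
    have hjN := hpos j (Finset.mem_insert_self _ _)
    have e1 : ((Finset.range (2 ^ N)).filter fun v => ∀ i ∈ insert j s, v.testBit (pos i) = β i) =
        S.filter fun v => v.testBit (pos j) = β j := by
      ext v
      simp only [hS, Finset.mem_filter, Finset.forall_mem_insert]
      tauto
    -- Toggling bit `pos j` is an involution of `S`, because the other prescribed bits sit
    -- elsewhere. It exchanges the two values of that bit, so exactly half of `S` survives the new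
    -- condition.
    have hflip : ∀ v ∈ S, v ^^^ 2 ^ pos j ∈ S := by
      intro v hv
      rw [hS, Finset.mem_filter, Finset.mem_range] at hv ⊢
      refine ⟨Nat.xor_lt_two_pow hv.1 (Nat.pow_lt_pow_right one_lt_two hjN), fun i hi => ?_⟩
      have hne : pos j ≠ pos i := by
        intro h
        refine hj (?_ : j ∈ s)
        rwa [hinj (Finset.mem_insert_self _ _) (Finset.mem_insert_of_mem hi) h]
      rw [Nat.testBit_xor, Nat.testBit_two_pow_of_ne hne, Bool.xor_false, hv.2 i hi]
    have e2 : (S.filter fun v => v.testBit (pos j) = β j).card =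
        (S.filter fun v => ¬ v.testBit (pos j) = β j).card := by
      refine Finset.card_bij' (fun v _ => v ^^^ 2 ^ pos j) (fun v _ => v ^^^ 2 ^ pos j) ?_ ?_ ?_ ?_
      · intro v hv
        rw [Finset.mem_filter] at hv ⊢
        refine ⟨hflip v hv.1, ?_⟩
        simp [Nat.testBit_xor, Nat.testBit_two_pow_self, hv.2]
      · intro v hv
        rw [Finset.mem_filter] at hv ⊢
        refine ⟨hflip v hv.1, ?_⟩
        have := hv.2
        simp only [Nat.testBit_xor, Nat.testBit_two_pow_self, Bool.xor_true]
        cases h : v.testBit (pos j) <;> cases h' : β j <;> simp_all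
      · intro v _
        simp
      · intro v _
        simp
    have e3 := Finset.card_filter_add_card_filter_not (s := S) (fun v => v.testBit (pos j) = β j)
    rw [e1, Finset.card_insert_of_notMem hj, ← ih', ← e3, ← e2]
    ring

/-! ### Cancellation of deviations on a line -/

section Counting

variable {ι : Type*} [Fintype ι] {b o : ι → ℕ} {β : ι → Bool}

/-- The deviation from its expected value of the indicator of the occurrences of a pattern on the
line `a ↦ 2 ^ a * m`. -/
noncomputable def patternDeviation (b o : ι → ℕ) (β : ι → Bool) (m a : ℕ) : ℝ :=
  (if ∀ i, windowDigit (a + b i) (o i * m) = β i then 1 else 0) - ((2 : ℝ) ^ Fintype.card ι)⁻¹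

theorem abs_patternDeviation_le_one (m a : ℕ) : |patternDeviation b o β m a| ≤ 1 := by
  have h0 : 0 < ((2 : ℝ) ^ Fintype.card ι)⁻¹ := by positivity
  have h1 : ((2 : ℝ) ^ Fintype.card ι)⁻¹ ≤ 1 := inv_le_one_of_one_le₀ (one_le_pow₀ one_le_two)
  rw [patternDeviation, abs_le]
  split_ifs <;> constructor <;> linarith

/-- The length of a full period of windows in stage `s`. -/
def periodLength (s : ℕ) : ℕ :=
  2 ^ s * 2 ^ (2 ^ s * 2 ^ s)

theorem periodLength_pos (s : ℕ) : 0 < periodLength s := by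
  unfold periodLength
  positivity

/-- The window has number `2 ^ (2 ^ s * 2 ^ s) * q + v`, and only bits below position `2 ^ s * 2 ^
s` are read, so `q` plays no role. -/
theorem windowDigit_period {s q v t : ℕ} (m : ℕ)
    (hs : stage (periodLength s * q + (2 ^ s * v + t)) = s) (hv : v < 2 ^ (2 ^ s * 2 ^ s))
    (ht : t < 2 ^ s) :
    windowDigit (periodLength s * q + (2 ^ s * v + t)) m = v.testBit (t * 2 ^ s + m % 2 ^ s) := by
  have h2 : 0 < 2 ^ s := by positivity
  have e : periodLength s * q + (2 ^ s * v + t) = t + 2 ^ s * (2 ^ (2 ^ s * 2 ^ s) * q + v) := by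
    rw [periodLength]
    ring
  rw [windowDigit, hs, e, Nat.add_mul_div_left _ _ h2, Nat.add_mul_mod_self_left,
    Nat.div_eq_of_lt ht, Nat.mod_eq_of_lt ht, zero_add, Nat.testBit_two_pow_mul_add _ hv, if_pos]
  have := Nat.mod_lt m h2
  nlinarith

/-- With `n = 2 ^ s`, this fixes the offset `t` inside a window and lets the window number vary. -/
theorem sum_range_mul_eq (f : ℕ → ℝ) (n k : ℕ) :
    ∑ x ∈ Finset.range (n * k), f x =
      ∑ t ∈ Finset.range n, ∑ v ∈ Finset.range k, f (n * v + t) := by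
  induction k with
  | zero => simp
  | succ k ih =>
    rw [Nat.mul_succ, Finset.sum_range_add, ih, ← Finset.sum_add_distrib]
    exact Finset.sum_congr rfl fun t _ => (Finset.sum_range_succ _ _).symm

/-- Because `t + d < 2 ^ s`, the whole pattern stays in one window, where its cells read pairwise
distinct bits of `v`. As `v` runs over all numbers with that many bits, `card_filter_testBit` gives
the exact frequency. -/
theorem sum_patternDeviation_window_eq_zero {s q m d t : ℕ} (hinj : Function.Injective fun i => (b i, o i))
    (hb : ∀ i, b i ≤ d) (ho : ∀ i, o i < 2 ^ s) (hm : ¬ 2 ∣ m)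
    (hstage : ∀ x < periodLength s, stage (periodLength s * q + x) = s) (ht : t + d < 2 ^ s) :
    ∑ v ∈ Finset.range (2 ^ (2 ^ s * 2 ^ s)),
      patternDeviation b o β m (periodLength s * q + (2 ^ s * v + t)) = 0 := by
  have h2 : 0 < 2 ^ s := by positivity
  set pos : ι → ℕ := fun i => (t + b i) * 2 ^ s + o i * m % 2 ^ s with hpos
  have hmod (i : ι) : o i * m % 2 ^ s < 2 ^ s := Nat.mod_lt _ h2
  have htb (i : ι) : t + b i < 2 ^ s := (Nat.add_le_add_left (hb i) t).trans_lt ht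
  have hposlt (i : ι) : pos i < 2 ^ s * 2 ^ s := by
    have := hmod i
    have := htb i
    simp only [hpos]
    nlinarith
  have hposinj : Function.Injective pos := by
    intro i j hij
    have hquot (i : ι) : pos i / 2 ^ s = t + b i := by
      simp only [hpos]
      rw [Nat.add_comm, Nat.add_mul_div_right _ _ h2, Nat.div_eq_of_lt (hmod i), zero_add]
    have hdiv : t + b i = t + b j := by rw [← hquot i, ← hquot j, hij]
    have hres : o i * m % 2 ^ s = o j * m % 2 ^ s := by
      simpa only [hpos, hdiv, Nat.add_left_cancel_iff] using hij
    -- Oddness of `m` enters here: it can be cancelled modulo `2 ^ s`, and the `o i` are smaller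
    -- than `2 ^ s`.
    have hcop : Nat.gcd (2 ^ s) m = 1 :=
      Nat.Coprime.pow_left s ((Nat.Prime.coprime_iff_not_dvd Nat.prime_two).2 hm)
    have ho' : o i ≡ o j [MOD 2 ^ s] := Nat.ModEq.cancel_right_of_coprime hcop hres
    exact hinj (Prod.ext (Nat.add_left_cancel hdiv) (ho'.eq_of_lt_of_lt (ho i) (ho j)))
  have hdigit : ∀ v < 2 ^ (2 ^ s * 2 ^ s), ∀ i,
      windowDigit (periodLength s * q + (2 ^ s * v + t) + b i) (o i * m) = v.testBit (pos i) := by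
    intro v hv i
    rw [add_assoc, add_assoc]
    refine windowDigit_period _ (hstage _ ?_) hv (htb i)
    calc 2 ^ s * v + (t + b i) < 2 ^ s * v + 2 ^ s := Nat.add_lt_add_left (htb i) _
      _ = 2 ^ s * (v + 1) := by ring
      _ ≤ _ := Nat.mul_le_mul_left _ hv
  have hcount := card_filter_testBit pos β (2 ^ s * 2 ^ s) Finset.univ (fun i _ => hposlt i)
    hposinj.injOn
  have hcount' : (((Finset.range (2 ^ (2 ^ s * 2 ^ s))).filter
      fun v => ∀ i, v.testBit (pos i) = β i).card : ℝ) * 2 ^ Fintype.card ι =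
      2 ^ (2 ^ s * 2 ^ s) := by
    simpa using congrArg (Nat.cast : ℕ → ℝ) hcount
  have hsum : ∑ v ∈ Finset.range (2 ^ (2 ^ s * 2 ^ s)),
      patternDeviation b o β m (periodLength s * q + (2 ^ s * v + t)) =
      ∑ v ∈ Finset.range (2 ^ (2 ^ s * 2 ^ s)),
        ((if ∀ i, v.testBit (pos i) = β i then (1 : ℝ) else 0) - ((2 : ℝ) ^ Fintype.card ι)⁻¹) := by
    refine Finset.sum_congr rfl fun v hv => ?_
    simp only [patternDeviation, hdigit v (Finset.mem_range.1 hv)]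
  rw [hsum, Finset.sum_sub_distrib, Finset.sum_boole, Finset.sum_const, Finset.card_range,
    nsmul_eq_mul, sub_eq_zero, eq_comm, ← div_eq_mul_inv, div_eq_iff (by positivity), hcount']
  norm_cast

/-- Over a full period inside stage `s` the deviations nearly cancel. -/
theorem abs_sum_patternDeviation_period_le {s q m d : ℕ}
    (hinj : Function.Injective fun i => (b i, o i))
    (hb : ∀ i, b i ≤ d) (ho : ∀ i, o i < 2 ^ s) (hm : ¬ 2 ∣ m)
    (hstage : ∀ x < periodLength s, stage (periodLength s * q + x) = s) :
    |∑ x ∈ Finset.range (periodLength s), patternDeviation b o β m (periodLength s * q + x)| ≤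
      d * 2 ^ (2 ^ s * 2 ^ s) := by
  set N := 2 ^ s * 2 ^ s with hN
  have e : periodLength s = 2 ^ s * 2 ^ N := rfl
  nth_rw 1 [e]
  rw [sum_range_mul_eq]
  refine (Finset.abs_sum_le_sum_abs _ _).trans ?_
  have hle : ∀ t ∈ Finset.range (2 ^ s), |∑ v ∈ Finset.range (2 ^ N),
      patternDeviation b o β m (periodLength s * q + (2 ^ s * v + t))| ≤
      if t + d < 2 ^ s then (0 : ℝ) else 2 ^ N := by
    intro t _
    split_ifs with h
    · rw [sum_patternDeviation_window_eq_zero hinj hb ho hm hstage h, abs_zero]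
    · refine (Finset.abs_sum_le_sum_abs _ _).trans
        ((Finset.sum_le_sum fun v _ => abs_patternDeviation_le_one m _).trans ?_)
      simp
  refine (Finset.sum_le_sum hle).trans ?_
  -- Only the last `d` offsets of a window let the pattern spill into the next one.
  have hcard : ((Finset.range (2 ^ s)).filter fun t => ¬ t + d < 2 ^ s).card ≤ d := by
    have : ((Finset.range (2 ^ s)).filter fun t => ¬ t + d < 2 ^ s) ⊆
        Finset.Ico (2 ^ s - d) (2 ^ s) := by
      intro t
      simp only [Finset.mem_filter, Finset.mem_range, Finset.mem_Ico]
      omega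
    refine (Finset.card_le_card this).trans ?_
    rw [Nat.card_Ico]
    omega
  rw [Finset.sum_ite, Finset.sum_const_zero, zero_add, Finset.sum_const, nsmul_eq_mul]
  gcongr

/-! ### Fitting periods into stages and summing over initial segments -/

theorem periodLength_dvd_periodLength {s s' : ℕ} (h : s ≤ s') :
    periodLength s ∣ periodLength s' := by
  have h1 : 2 ^ s ≤ 2 ^ s' := Nat.pow_le_pow_right two_pos h
  exact mul_dvd_mul (pow_dvd_pow 2 h) (pow_dvd_pow 2 (Nat.mul_le_mul h1 h1))

/-- This is why the stage thresholds are `2 ^ 16 ^ s`: the exponent `2 * s + 4 ^ s` is at most `16 ^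
s`. Thresholds are thus multiples of the period, and a period is at most a fraction `2 ^ (-s)` of
any number in stage `s`. -/
theorem two_pow_mul_periodLength_dvd {s s' : ℕ} (hs : 1 ≤ s) (h : s ≤ s') :
    2 ^ s * periodLength s ∣ 2 ^ 16 ^ s' := by
  rw [periodLength, ← pow_add, ← pow_add, ← pow_add]
  refine pow_dvd_pow 2 (le_trans ?_ (Nat.pow_le_pow_right (by norm_num) h))
  have h1 : s < 2 ^ s := Nat.lt_two_pow_self
  have h2 : 2 ≤ 2 ^ s := by simpa using Nat.pow_le_pow_right two_pos hs
  have e1 : 2 ^ (s + s) = 2 ^ s * 2 ^ s := pow_add ..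
  have e2 : 16 ^ s = (2 ^ s * 2 ^ s) * (2 ^ s * 2 ^ s) := by
    rw [← mul_pow, ← mul_pow]
    norm_num
  rw [e1, e2]
  nlinarith [Nat.mul_le_mul h2 h2]

theorem periodLength_dvd {s s' : ℕ} (hs : 1 ≤ s) (h : s ≤ s') : periodLength s ∣ 2 ^ 16 ^ s' :=
  dvd_of_mul_left_dvd (two_pow_mul_periodLength_dvd hs h)

/-- The periods do not cross the boundaries of the stages. -/
theorem stage_period {s q x y : ℕ} (hs : 1 ≤ s) (hx : x < periodLength s)
    (hy : y < periodLength s) (h : stage (periodLength s * q + y) = s) :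
    stage (periodLength s * q + x) = s := by
  have key : ∀ s' ≥ s, ∀ z < periodLength s, (s' ≤ stage (periodLength s * q + z) ↔
      2 ^ 16 ^ s' ≤ periodLength s * q) := by
    intro s' hs' z hz
    rw [le_stage_iff (hs.trans hs')]
    refine ⟨fun hle => ?_, fun hle => hle.trans (Nat.le_add_right _ _)⟩
    -- The threshold is a multiple of the period, so it cannot fall strictly inside a period.
    obtain ⟨c, hc⟩ := periodLength_dvd hs hs'
    rw [hc] at hle ⊢
    refine Nat.mul_le_mul_left _ (Nat.lt_succ_iff.1 ?_)
    refine Nat.lt_of_mul_lt_mul_left (a := periodLength s) (hle.trans_lt ?_)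
    rw [Nat.mul_succ]
    exact Nat.add_lt_add_left hz _
  have h1 := (key s le_rfl y hy).1 h.ge
  have h2 : ¬ 2 ^ 16 ^ (s + 1) ≤ periodLength s * q := fun h' => by
    have := (key (s + 1) (Nat.le_succ s) y hy).2 h'
    omega
  have h3 := (key s le_rfl x hx).2 h1
  have h4 := mt (key (s + 1) (Nat.le_succ s) x hx).1 h2
  omega

/-- The sum of the deviations over an initial segment of full periods. -/
theorem abs_sum_patternDeviation_le_of_dvd {m d s₀ : ℕ} {δ : ℝ} (hδ : 0 ≤ δ) (hs₀ : 1 ≤ s₀)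
    (hinj : Function.Injective fun i => (b i, o i)) (hb : ∀ i, b i ≤ d)
    (ho : ∀ i, o i < 2 ^ s₀) (hd : d ≤ δ * 2 ^ s₀) (hm : ¬ 2 ∣ m) (k : ℕ)
    (hk : periodLength (stage k) ∣ k) :
    |∑ a ∈ Finset.range k, patternDeviation b o β m a| ≤ 2 ^ 16 ^ s₀ + δ * k := by
  induction k using Nat.strong_induction_on with
  | _ k ih =>
    rcases le_or_gt k (2 ^ 16 ^ s₀) with hle | hlt
    · refine (Finset.abs_sum_le_sum_abs _ _).trans
        ((Finset.sum_le_sum fun a _ => abs_patternDeviation_le_one m a).trans ?_)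
      have h1 : (k : ℝ) ≤ 2 ^ 16 ^ s₀ := by exact_mod_cast hle
      have h2 : 0 ≤ δ * k := by positivity
      simp only [Finset.sum_const, Finset.card_range, nsmul_eq_mul, mul_one]
      linarith
    -- The last full period before `k` is peeled off. Its stage is that of `k - 1`, since `k` itself
    -- may be the first element of a new stage.
    · set s := stage (k - 1) with hs
      have hs0s : s₀ ≤ s := (le_stage_iff hs₀).2 (by omega)
      have hs1 : 1 ≤ s := hs₀.trans hs0s
      have hss : s ≤ stage k :=
        (le_stage_iff hs1).2 (((le_stage_iff hs1).1 le_rfl).trans (Nat.sub_le _ _))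
      obtain ⟨c, hc⟩ := (periodLength_dvd_periodLength hss).trans hk
      have hP := periodLength_pos s
      obtain ⟨q, rfl⟩ : ∃ q, c = q + 1 := by
        refine Nat.exists_eq_succ_of_ne_zero ?_
        rintro rfl
        simp [hc] at hlt
      have hk1 : k - 1 = periodLength s * q + (periodLength s - 1) := by
        rw [hc, Nat.mul_succ]
        omega
      have hst : ∀ x < periodLength s, stage (periodLength s * q + x) = s := fun x hx =>
        stage_period hs1 hx (Nat.sub_lt hP one_pos) (by rw [← hk1])
      have hprev := ih (periodLength s * q) (by rw [hc, Nat.mul_succ]; omega)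
        (by rw [show stage (periodLength s * q) = s from hst 0 hP]; exact dvd_mul_right _ _)
      have hper := abs_sum_patternDeviation_period_le (β := β) hinj hb
        (fun i => (ho i).trans_le (Nat.pow_le_pow_right two_pos hs0s)) hm hst
      have hds : (d : ℝ) ≤ δ * 2 ^ s :=
        hd.trans (mul_le_mul_of_nonneg_left (pow_le_pow_right₀ one_le_two hs0s) hδ)
      have hper' : (d : ℝ) * 2 ^ (2 ^ s * 2 ^ s) ≤ δ * periodLength s := by
        have : (periodLength s : ℝ) = 2 ^ s * 2 ^ (2 ^ s * 2 ^ s) := by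
          simp [periodLength]
        rw [this, ← mul_assoc]
        exact mul_le_mul_of_nonneg_right hds (by positivity)
      have hkc : (k : ℝ) = (periodLength s * q : ℕ) + periodLength s := by
        rw [hc, Nat.mul_succ]
        push_cast
        ring
      rw [hkc, show k = periodLength s * q + periodLength s by rw [hc, Nat.mul_succ],
        Finset.sum_range_add]
      refine (abs_add_le _ _).trans ?_
      linarith

/-- An arbitrary `k` leaves one incomplete period, of length at most `δ * k`; this accounts for the
factor `2`. -/
theorem abs_sum_patternDeviation_le {m d s₀ : ℕ} {δ : ℝ} (hδ : 0 ≤ δ) (hs₀ : 1 ≤ s₀)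
    (hinj : Function.Injective fun i => (b i, o i)) (hb : ∀ i, b i ≤ d)
    (ho : ∀ i, o i < 2 ^ s₀) (hd : d ≤ δ * 2 ^ s₀) (hd1 : 1 ≤ δ * 2 ^ s₀) (hm : ¬ 2 ∣ m) (k : ℕ) :
    |∑ a ∈ Finset.range k, patternDeviation b o β m a| ≤ 2 ^ 16 ^ s₀ + 2 * δ * k := by
  have htriv (f : ℕ → ℕ) (n : ℕ) :
      |∑ a ∈ Finset.range n, patternDeviation b o β m (f a)| ≤ n := by
    refine (Finset.abs_sum_le_sum_abs _ _).trans
      ((Finset.sum_le_sum fun a _ => abs_patternDeviation_le_one m _).trans ?_)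
    simp
  rcases le_or_gt k (2 ^ 16 ^ s₀) with hle | hlt
  · have h1 : (k : ℝ) ≤ 2 ^ 16 ^ s₀ := by exact_mod_cast hle
    have h2 : 0 ≤ 2 * δ * k := by positivity
    exact (htriv id k).trans (by linarith)
  · set s := stage k with hs
    have hs0s : s₀ ≤ s := (le_stage_iff hs₀).2 hlt.le
    have hs1 : 1 ≤ s := hs₀.trans hs0s
    have hP := periodLength_pos s
    set q := k / periodLength s with hq
    have hkq : periodLength s * q + k % periodLength s = k := Nat.div_add_mod _ _
    have hr : k % periodLength s < periodLength s := Nat.mod_lt _ hP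
    have hst : stage (periodLength s * q) = s :=
      stage_period (x := 0) hs1 hP hr (by rw [hkq])
    have h1 := abs_sum_patternDeviation_le_of_dvd (β := β) hδ hs₀ hinj hb ho hd hm
      (periodLength s * q) (by rw [hst]; exact dvd_mul_right _ _)
    have h2 := htriv (fun a => periodLength s * q + a) (k % periodLength s)
    have h3 : ((k % periodLength s : ℕ) : ℝ) ≤ periodLength s := by exact_mod_cast hr.le
    have h4 : ((periodLength s * q : ℕ) : ℝ) ≤ k := by
      exact_mod_cast (Nat.le_add_right _ _).trans_eq hkq
    have h5 : (periodLength s : ℝ) ≤ δ * k := by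
      have h6 : 2 ^ s * periodLength s ≤ k :=
        (Nat.le_of_dvd (by positivity) (two_pow_mul_periodLength_dvd hs1 le_rfl)).trans
          ((le_stage_iff hs1).1 le_rfl)
      have h7 : (2 : ℝ) ^ s * periodLength s ≤ k := by exact_mod_cast h6
      have h8 : 1 ≤ δ * 2 ^ s :=
        hd1.trans (mul_le_mul_of_nonneg_left (pow_le_pow_right₀ one_le_two hs0s) hδ)
      calc (periodLength s : ℝ) ≤ δ * 2 ^ s * periodLength s :=
            le_mul_of_one_le_left (Nat.cast_nonneg _) h8
        _ = δ * (2 ^ s * periodLength s) := by ring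
        _ ≤ δ * k := mul_le_mul_of_nonneg_left h7 hδ
    have h9 : δ * ((periodLength s * q : ℕ) : ℝ) ≤ δ * k := mul_le_mul_of_nonneg_left h4 hδ
    rw [show Finset.range k = Finset.range (periodLength s * q + k % periodLength s) by rw [hkq],
      Finset.sum_range_add]
    refine (abs_add_le _ _).trans ?_
    linarith

/-- The deviations average out along the lines `a ↦ 2 ^ a * m`, uniformly in the odd number
`m`. -/
theorem exists_abs_sum_patternDeviation_le (hinj : Function.Injective fun i => (b i, o i)) (β : ι → Bool)
    {ε : ℝ} (hε : 0 < ε) :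
    ∃ k₀, ∀ m, ¬ 2 ∣ m → ∀ k ≥ k₀,
      |∑ a ∈ Finset.range k, patternDeviation b o β m a| ≤ ε * k := by
  obtain ⟨d, hd⟩ : ∃ d, ∀ i, b i ≤ d :=
    ⟨∑ i, b i, fun i => Finset.single_le_sum (fun _ _ => Nat.zero_le _) (Finset.mem_univ i)⟩
  obtain ⟨O, hO⟩ : ∃ O, ∀ i, o i ≤ O :=
    ⟨∑ i, o i, fun i => Finset.single_le_sum (fun _ _ => Nat.zero_le _) (Finset.mem_univ i)⟩
  -- In `s₀`, the summand `M` makes the spilling offsets rare (`δ = ε / 4`), and `O` ensures `o i <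
  -- 2 ^ s₀`. Then `k₀` absorbs the uncontrolled segment below `2 ^ 16 ^ s₀` into the other `ε / 2`.
  obtain ⟨M, hM⟩ := exists_nat_gt ((d + 1) / (ε / 4))
  set s₀ := M + O + 1 with hs₀
  have hpow : s₀ < 2 ^ s₀ := Nat.lt_two_pow_self
  have hM' : (d : ℝ) + 1 ≤ ε / 4 * 2 ^ s₀ := by
    rw [div_lt_iff₀ (by positivity)] at hM
    have : (M : ℝ) ≤ 2 ^ s₀ := by
      have : M ≤ 2 ^ s₀ := by omega
      exact_mod_cast this
    nlinarith
  obtain ⟨k₀, hk₀⟩ := exists_nat_gt ((2 : ℝ) ^ 16 ^ s₀ / (ε / 2))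
  refine ⟨k₀, fun m hm k hk => ?_⟩
  have h1 := abs_sum_patternDeviation_le (β := β) (by positivity : 0 ≤ ε / 4)
    (by omega : 1 ≤ s₀) hinj hd (fun i => (hO i).trans_lt (by omega))
    (by linarith) (by linarith [Nat.cast_nonneg (α := ℝ) d]) hm k
  have h2 : (k₀ : ℝ) ≤ k := by exact_mod_cast hk
  rw [div_lt_iff₀ (by positivity)] at hk₀
  nlinarith

end Counting

/-! ### Net-normality of the constructed set -/

theorem indicator_normalSet_eq_iff (n : ℕ+) (c : Fin 2) :
    normalSet.indicator (1 : ℕ+ → Fin 2) n = c ↔ normalDigit n = decide (c = 1) := by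
  classical
  rw [Set.indicator_apply]
  have : n ∈ normalSet ↔ normalDigit n = true := Iff.rfl
  rw [this]
  cases normalDigit n <;> fin_cases c <;> simp

/-- The number of all occurrences of a pattern at divisors of `L`, including those that are not
contained in the set of divisors. -/
theorem exists_abs_card_filter_normalDigit_sub_le (K : Finset ℕ+) (β : K → Bool) {ε : ℝ}
    (hε : 0 < ε) :
    ∃ L₀ ≠ 0, ∀ L ≠ 0, L₀ ∣ L →
      |((L.divisors.filter fun d => ∀ h : K, normalDigit ((h : ℕ+) * d) = β h).card : ℝ) -
        L.divisors.card * ((2 : ℝ) ^ K.card)⁻¹| ≤ ε * L.divisors.card := by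
  have hfac (h : K) : ∃ x : ℕ × ℕ, ¬ 2 ∣ x.2 ∧ ((h : ℕ+) : ℕ) = 2 ^ x.1 * x.2 := by
    obtain ⟨a, m, h1, h2⟩ := exists_eq_prime_pow_mul Nat.prime_two (PNat.ne_zero (h : ℕ+))
    exact ⟨(a, m), h1, h2⟩
  choose x hodd hx using hfac
  have hinj : Function.Injective fun h => ((x h).1, (x h).2) := by
    intro h h' he
    have he' : x h = x h' := he
    exact Subtype.ext (PNat.eq (by rw [hx, hx, he']))
  obtain ⟨k₀, hk₀⟩ := exists_abs_sum_patternDeviation_le hinj β hε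
  -- A power of `2` suffices because the bound on lines is uniform in the odd part `m`.
  refine ⟨2 ^ k₀, by positivity, fun L hL hdvd => ?_⟩
  obtain ⟨k, M, hM, rfl⟩ := exists_eq_prime_pow_mul Nat.prime_two hL
  have hk : k₀ ≤ k + 1 := by
    have h5 := Nat.Coprime.dvd_of_dvd_mul_right
      (Nat.Coprime.pow_left k₀ ((Nat.Prime.coprime_iff_not_dvd Nat.prime_two).2 hM)) hdvd
    exact ((Nat.pow_dvd_pow_iff_le_right one_lt_two).1 h5).trans (Nat.le_succ k)
  have hcard : ((2 ^ k * M).divisors.card : ℝ) = ∑ m ∈ M.divisors, ((k + 1 : ℕ) : ℝ) := by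
    have := sum_divisors_prime_pow_mul Nat.prime_two k hM (fun _ => (1 : ℝ))
    simpa using this
  have hsum : ((((2 ^ k * M).divisors.filter
        fun d => ∀ h : K, normalDigit ((h : ℕ+) * d) = β h).card : ℕ) : ℝ) -
        (2 ^ k * M).divisors.card * ((2 : ℝ) ^ K.card)⁻¹ =
      ∑ m ∈ M.divisors, ∑ a ∈ Finset.range (k + 1),
        patternDeviation (fun h => (x h).1) (fun h => (x h).2) β m a := by
    rw [← Finset.sum_boole, ← nsmul_eq_mul, ← Finset.sum_const, ← Finset.sum_sub_distrib,
      sum_divisors_prime_pow_mul Nat.prime_two k hM]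
    refine Finset.sum_congr rfl fun m hm => Finset.sum_congr rfl fun a _ => ?_
    have hm2 : ¬ 2 ∣ m := fun h => hM (h.trans (Nat.dvd_of_mem_divisors hm))
    have hdig (h : K) : normalDigit ((h : ℕ+) * (2 ^ a * m)) =
        windowDigit (a + (x h).1) ((x h).2 * m) := by
      rw [hx h, ← normalDigit_two_pow_mul _ (Nat.prime_two.not_dvd_mul (hodd h) hm2)]
      congr 1
      ring
    simp only [patternDeviation, hdig, Fintype.card_coe]
  rw [hsum, hcard, Finset.mul_sum]
  refine (Finset.abs_sum_le_sum_abs _ _).trans (Finset.sum_le_sum fun m hm => ?_)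
  exact hk₀ m (fun h => hM (h.trans (Nat.dvd_of_mem_divisors hm))) (k + 1) hk

/-- A union bound over `K`; it controls the occurrences that are not contained in the box. -/
theorem exists_card_filter_exists_not_mul_dvd_le (K : Finset ℕ+) {ε : ℝ} (hε : 0 < ε) :
    ∃ L₀ ≠ 0, ∀ L ≠ 0, L₀ ∣ L →
      ((L.divisors.filter fun d => ∃ h ∈ K, ¬ (h : ℕ) * d ∣ L).card : ℝ) ≤
        ε * L.divisors.card := by
  induction K using Finset.induction_on generalizing ε with
  | empty =>
    refine ⟨1, one_ne_zero, fun L _ _ => ?_⟩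
    simp only [Finset.notMem_empty, false_and, exists_false, Finset.filter_false, Finset.card_empty,
      Nat.cast_zero]
    positivity
  | insert g K _ ih =>
    obtain ⟨L₁, hL₁, H₁⟩ := ih (half_pos hε)
    obtain ⟨L₂, hL₂, H₂⟩ := exists_card_filter_not_mul_dvd_le g.ne_zero (half_pos hε)
    refine ⟨L₁ * L₂, mul_ne_zero hL₁ hL₂, fun L hL hdvd => ?_⟩
    have h1 := H₁ L hL (dvd_of_mul_right_dvd hdvd)
    have h2 := H₂ L hL (dvd_of_mul_left_dvd hdvd)
    have h3 : ((L.divisors.filter fun d => ∃ h ∈ insert g K, ¬ (h : ℕ) * d ∣ L).card : ℝ) ≤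
        (L.divisors.filter fun d => ¬ (g : ℕ) * d ∣ L).card +
          (L.divisors.filter fun d => ∃ h ∈ K, ¬ (h : ℕ) * d ∣ L).card := by
      simp only [Finset.exists_mem_insert, Finset.filter_or]
      exact_mod_cast Finset.card_union_le _ _
    linarith

theorem isNetNormal_normalSet : IsNetNormal normalSet := by
  intro K hK B
  rw [Metric.tendsto_nhds]
  intro ε hε
  have hε3 : 0 < ε / 3 := by positivity
  obtain ⟨L₁, hL₁, H₁⟩ := exists_card_filter_exists_not_mul_dvd_le K hε3
  obtain ⟨L₂, hL₂, H₂⟩ :=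
    exists_abs_card_filter_normalDigit_sub_le K (fun h => decide (B h = 1)) hε3
  obtain ⟨j, hj⟩ := ofExponents_surjective ⟨L₁ * L₂, Nat.pos_of_ne_zero (mul_ne_zero hL₁ hL₂)⟩
  filter_upwards [eventually_ge_atTop (⟨anchoredBox j, j, rfl⟩ : AnchoredBoxes)]
  rintro ⟨_, k, rfl⟩ hjk
  have hdvd : L₁ * L₂ ∣ ofExponents k := by
    have := anchoredBox_subset_iff.1 hjk
    rwa [hj] at this
  set L : ℕ := ((ofExponents k : ℕ+) : ℕ) with hL
  have hL0 : L ≠ 0 := PNat.ne_zero _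
  have h1 := H₁ L hL0 (dvd_of_mul_right_dvd hdvd)
  have h2 := H₂ L hL0 (dvd_of_mul_left_dvd hdvd)
  have h0 := card_divisors_pos hL0
  have hocc : (blockOccurrences B (normalSet.indicator 1) (anchoredBox k)).ncard =
      (L.divisors.filter fun d => ∀ h : K, ((h : ℕ+) : ℕ) * d ∣ L ∧
        normalDigit ((h : ℕ+) * d) = decide (B h = 1)).card := by
    refine ncard_setOf_eq_card_filter_divisors hL0 _ _ fun d => ?_
    -- An element of `K` is needed to see that an occurrence is at a divisor of `L`; for empty `K`
    -- every position would count.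
    obtain ⟨g, hg⟩ := hK
    simp only [blockOccurrences, Set.mem_ofPred_eq, mem_anchoredBox, indicator_normalSet_eq_iff,
      PNat.mul_coe, ← hL]
    exact ⟨fun h => ⟨dvd_of_mul_left_dvd (h ⟨g, hg⟩).1, h⟩, fun h => h.2⟩
  set N₁ := (L.divisors.filter fun d => ∀ h : K, ((h : ℕ+) : ℕ) * d ∣ L ∧
        normalDigit ((h : ℕ+) * d) = decide (B h = 1)).card
  set N₂ := (L.divisors.filter fun d => ∀ h : K,
        normalDigit ((h : ℕ+) * d) = decide (B h = 1)).card
  set N₃ := (L.divisors.filter fun d => ∃ h ∈ K, ¬ (h : ℕ) * d ∣ L).card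
  have h12 : (N₁ : ℝ) ≤ N₂ := by
    refine Nat.cast_le.2 (Finset.card_le_card fun d => ?_)
    simp only [Finset.mem_filter]
    exact fun h => ⟨h.1, fun g => (h.2 g).2⟩
  have h123 : (N₂ : ℝ) ≤ N₁ + N₃ := by
    refine (Nat.cast_le.2 ((Finset.card_le_card fun d hd => ?_).trans
      (Finset.card_union_le _ _))).trans_eq (Nat.cast_add _ _)
    simp only [Finset.mem_union, Finset.mem_filter] at hd ⊢
    by_cases h : ∃ h ∈ K, ¬ (h : ℕ) * d ∣ L
    · exact Or.inr ⟨hd.1, h⟩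
    · push Not at h
      exact Or.inl ⟨hd.1, fun g => ⟨h g g.2, hd.2 g⟩⟩
  rw [blockFrequency, hocc, card_anchoredBox, ← hL, Real.dist_eq, div_sub' h0.ne', abs_div,
    abs_of_pos h0, div_lt_iff₀ h0]
  rw [abs_le] at h2
  rw [abs_lt]
  have := mul_pos hε h0
  constructor <;> linarith

theorem mainTheorem3 :
    (∃ A : Set ℕ+, IsEffectivelyDefined A ∧ IsNetNormal A ∧
      ∀ F : ℕ → Finset ℕ+, IsNiceFolnerSequence F → IsNormalAlong F A) ∧
    ∀ A : Set ℕ+, IsNetNormal A ↔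
      ∀ F : ℕ → Finset ℕ+, IsNiceFolnerSequence F → IsNormalAlong F A :=
  ⟨⟨normalSet, isEffectivelyDefined_normalSet, isNetNormal_normalSet,
    (isNetNormal_iff normalSet).1 isNetNormal_normalSet⟩, isNetNormal_iff⟩
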